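/- **Setting ($k=3$).** The 3-bonacci vectors $X_{-n}\in\mathbb Z^2$ ($n\ge 0$) are given by $X_0=(0,0)$, $X_{-1}=(1,0)$, $X_{-2}=(0,1)$ and $X_{-(n+3)}=X_{-n}-X_{-(n+1)}-X_{-(n+2)}$ for $n\ge 0$. *Small steps decomposition* of $u=(u_1,u_2)\in\mathbb Z^2$: if $u$ has a negative entry, put $m=\min(u_1,u_2)$ and write $u$ as $|m|$ copies of $X_{-3}=(-1,-1)$, $u_1-m$ copies of $X_{-1}$ and $u_2-m$ copies of $X_{-2}$; otherwise write $u$ as $u_1$ copies of $X_{-1}$ and $u_2$ copies of $X_{-2}$. *Large steps decomposition* of $v\in\mathbb Z^2\setminus\{0\}$: let $v_1=v$; given $v_i$, choose $n_i\ge 1$ such that $\|v_i-X_{-n_i}\|_2$ is minimal (ties are broken arbitrarily) and put $v_{i+1}=v_i-X_{-n_i}$. Let $M$ be the least index with $\|v_{M+1}\|_2\ge\|v_M\|_2$. Keep $n_1,\dots,n_{M-1}$ and append the indices $n_M,\dots,n_N\in\{1,2,3\}$ of the small steps decomposition of $v_M$ (none if $v_M=0$). For the resulting decomposition $v=\sum_{i=1}^N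 X_{-n_i}$ set $$j_{lsb}=3(N-1)+\max_{1\le i\le N} n_i .$$ **Theorem.** For every $v\in\mathbb Z^2\setminus\{0\}$ the procedure can be carried out, and for every way of breaking ties it stops and yields a decomposition of $v$ with $N\ge1$. There are constants $c_3,d_3>0$ such that for all $v\in\mathbb Z^2\setminus\{0\}$ (and all ways of breaking ties) $$j_{lsb}\le c_3\log\|v\|_2+d_3 .$$ Hence $j_{lsb}=O(\log\|v\|_2)$ and $j_{lsb}=O(\log\|v\|_\infty)$; that is, for each of these two norms there are constants $c>0$ and $R$ such that $j_{lsb}\le c\,\bigl|\log\|v\|\bigr|$ for all nonzero $v\in\mathbb Z^2$ with $\|v\|\ge R$. -/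

import Mathlib

/-- The 3-bonacci vectors with nonpositive index: `tribVec n` is `X_{-n}`. They satisfy `X_0 = 0`,
`X_{-1} = e_1`, `X_{-2} = e_2` and the recurrence `X_m = X_{m-1} + X_{m-2} + X_{m-3}`, which for
`m = -n` is solved for `X_{-(n+3)}`. -/
def tribVec : ℕ → (Fin 2 → ℤ)
  | 0 => ![0, 0]
  | 1 => ![1, 0]
  | 2 => ![0, 1]
  | n + 3 => tribVec n - tribVec (n + 1) - tribVec (n + 2)

/-- The Euclidean norm of an integer vector. (The norm `‖v‖` of `v : Fin 2 → ℤ` is the sup norm.) -/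
noncomputable def l2norm (v : Fin 2 → ℤ) : ℝ :=
  ‖(WithLp.toLp 2 (fun i => (v i : ℝ)) : EuclideanSpace ℝ (Fin 2))‖

/-- `X_{-n}`, `n ≥ 1`, is a nearest vector to `v` among the `X_{-m}`, `m ≥ 1` (ties allowed). -/
def IsNearestIndex (v : Fin 2 → ℤ) (n : ℕ) : Prop :=
  1 ≤ n ∧ ∀ m : ℕ, 1 ≤ m → l2norm (v - tribVec n) ≤ l2norm (v - tribVec m)

/-- A run of the greedy procedure on `v`: `w 0 = v`, and `w (i + 1)` is obtained from `w i` by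
subtracting a nearest 3-bonacci vector `X_{-(n i)}`. It is continued indefinitely here; the place
where the procedure stops is singled out by `StopsAt`. -/
structure IsGreedyRun (v : Fin 2 → ℤ) (w : ℕ → (Fin 2 → ℤ)) (n : ℕ → ℕ) : Prop where
  start : w 0 = v
  nearest : ∀ i, IsNearestIndex (w i) (n i)
  step : ∀ i, w (i + 1) = w i - tribVec (n i)

/-- The run stops at the first vector `w M` that the next step fails to make strictly shorter;
exactly the steps `0, …, M - 1` are kept. -/
def StopsAt (w : ℕ → (Fin 2 → ℤ)) (M : ℕ) : Prop :=
  IsLeast {i : ℕ | l2norm (w i) ≤ l2norm (w (i + 1))} M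

/-- The small steps decomposition of `v`, as the list (with multiplicity) of the indices used.
If `v` has a negative entry and `m` is its least entry, take `|m|` copies of
`X_{-3} = (-1, -1)` and `v_j - m` copies of `X_{-j} = e_j`, `j = 1, 2`; otherwise take `v_j` copies
of `X_{-j}`. -/
def smallSteps (v : Fin 2 → ℤ) : List ℕ :=
  if v 0 < 0 ∨ v 1 < 0 then
    List.replicate (-(min (v 0) (v 1))).toNat 3 ++
      List.replicate (v 0 - min (v 0) (v 1)).toNat 1 ++
      List.replicate (v 1 - min (v 0) (v 1)).toNat 2
  else
    List.replicate (v 0).toNat 1 ++ List.replicate (v 1).toNat 2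

/-- The indices `n_1, …, n_N` of the large steps decomposition: the `M` greedy indices, followed by
those of the small steps decomposition of the remaining vector `w M`. -/
def largeStepsIndices (w : ℕ → (Fin 2 → ℤ)) (n : ℕ → ℕ) (M : ℕ) : List ℕ :=
  (List.range M).map n ++ smallSteps (w M)

/-- `k (N - 1) + max_i n_i` for `k = 3` and the nonempty list `l = [n_1, …, n_N]`. -/
def indexBound (l : List ℕ) : ℕ :=
  3 * (l.length - 1) + l.foldr max 0

/-- `j` is a value of `j_lsb` for `v`: it comes from some run of the large steps procedure (the
value may depend on how ties between nearest vectors are broken). -/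
def IsJLsb (v : Fin 2 → ℤ) (j : ℕ) : Prop :=
  ∃ (w : ℕ → (Fin 2 → ℤ)) (n : ℕ → ℕ) (M : ℕ),
    IsGreedyRun v w n ∧ StopsAt w M ∧ j = indexBound (largeStepsIndices w n M)

/-! The polynomial λ³ + λ² + λ - 1 of the backward recurrence has a real root t in (0, 1) and a
complex pair of modulus r = √(1/t) > 1. Hence X_{-n} has length of order r^n, up to an additive
constant. A combination of three consecutive X's with positive coefficients stays bounded, so at
scale r^n they cannot all lie on one side of a line (`exists_large_term`).

For large v some X of length a small multiple of ‖v‖ thus has a good component along v. Subtracting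
it shrinks v by a fixed factor, and a nearest vector does no worse (`exists_contraction`). So there
are O(log ‖v‖) greedy steps and the remainder is bounded. Each subtracted vector is a difference of
two iterates no longer than v, so its index is O(log ‖v‖) as well. -/

/-- The real root of `t ^ 3 + t ^ 2 + t = 1`, i.e. the reciprocal of the tribonacci constant. -/
theorem exists_tribonacci_root :
    ∃ t : ℝ, 27 / 50 ≤ t ∧ t ≤ 11 / 20 ∧ t ^ 3 + t ^ 2 + t = 1 := by
  have hc : ContinuousOn (fun t : ℝ => t ^ 3 + t ^ 2 + t) (Set.Icc (27 / 50) (11 / 20)) := by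
    fun_prop
  obtain ⟨t, ht, h⟩ := intermediate_value_Icc (by norm_num) hc
    (show (1 : ℝ) ∈ Set.Icc _ _ by constructor <;> norm_num)
  exact ⟨t, ht.1, ht.2, h⟩

/-! ### Scalar backward tribonacci sequences -/

/-- Real sequences with `x 0 = 0` and the backward tribonacci recurrence. -/
structure IsBackwardTrib (x : ℕ → ℝ) : Prop where
  zero : x 0 = 0
  step : ∀ n, x (n + 3) = x n - x (n + 1) - x (n + 2)

namespace IsBackwardTrib

variable {x : ℕ → ℝ} {t s : ℝ}

/-- The polynomial factors as (λ - t)(λ² + (1 + t)λ + s); applying the quadratic factor to x leaves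
only the t-mode. -/
theorem contracting_mode (hx : IsBackwardTrib x) (hs : s = t ^ 2 + t + 1) (hst : t * s = 1)
    (n : ℕ) :
    x (n + 2) + (1 + t) * x (n + 1) + s * x n = t ^ n * (x 2 + (1 + t) * x 1) := by
  induction n with
  | zero => simp [hx.zero]
  | succ n ih =>
    rw [pow_succ, mul_right_comm, ← ih, hx.step]
    subst hs
    linear_combination (-x n) * hst

/-- The differences x (n + 1) - t * x n lose the t-mode and obey the quadratic factor's recurrence.
Its norm form is multiplied by s, the product of the complex roots, at each step. -/
theorem form_eq (hx : IsBackwardTrib x) (hs : s = t ^ 2 + t + 1) (hst : t * s = 1) (n : ℕ) :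
    (x (n + 2) - t * x (n + 1)) ^ 2
        + (1 + t) * (x (n + 1) - t * x n) * (x (n + 2) - t * x (n + 1))
        + s * (x (n + 1) - t * x n) ^ 2
      = s ^ n * ((x 2 - t * x 1) ^ 2 + (1 + t) * x 1 * (x 2 - t * x 1) + s * x 1 ^ 2) := by
  induction n with
  | zero => simp [hx.zero]
  | succ n ih =>
    have key : x (n + 3) - t * x (n + 2)
        = -(1 + t) * (x (n + 2) - t * x (n + 1)) - s * (x (n + 1) - t * x n) := by
      rw [hx.step]
      subst hs
      linear_combination (-x n) * hst
    rw [pow_succ s, mul_right_comm (s ^ n), ← ih]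
    change (x (n + 3) - t * x (n + 2)) ^ 2
        + (1 + t) * (x (n + 2) - t * x (n + 1)) * (x (n + 3) - t * x (n + 2))
        + s * (x (n + 2) - t * x (n + 1)) ^ 2 = _
    rw [key]
    ring

end IsBackwardTrib

theorem trib_form_lower {t s a b : ℝ} (h1 : 27 / 50 ≤ t) (h2 : t ≤ 11 / 20) (h3 : 9 / 5 ≤ s) :
    (a ^ 2 + b ^ 2) / 5 ≤ b ^ 2 + (1 + t) * a * b + s * a ^ 2 := by
  have : (1 + t) * (a * b) ≥ -(31 / 40) * (a ^ 2 + b ^ 2) := by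
    nlinarith [mul_nonneg (by linarith : 0 ≤ 1 + t) (sq_nonneg (a + b)), sq_nonneg a, sq_nonneg b]
  nlinarith [mul_nonneg (by linarith : 0 ≤ s - 9 / 5) (sq_nonneg a), sq_nonneg a, sq_nonneg b]

theorem trib_form_upper {t s a b : ℝ} (h1 : 27 / 50 ≤ t) (h2 : t ≤ 11 / 20) (h3 : s ≤ 19 / 10) :
    b ^ 2 + (1 + t) * a * b + s * a ^ 2 ≤ (27 / 10) * (a ^ 2 + b ^ 2) := by
  have : (1 + t) * (a * b) ≤ (31 / 40) * (a ^ 2 + b ^ 2) := by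
    nlinarith [mul_nonneg (by linarith : 0 ≤ 1 + t) (sq_nonneg (a - b)), sq_nonneg a, sq_nonneg b]
  nlinarith [mul_nonneg (by linarith : 0 ≤ 19 / 10 - s) (sq_nonneg a), sq_nonneg a, sq_nonneg b]

namespace IsBackwardTrib

variable {x : ℕ → ℝ} {t s r V : ℝ}

theorem contracting_mode_abs_le (hx : IsBackwardTrib x) (h1 : 27 / 50 ≤ t) (h2 : t ≤ 11 / 20)
    (hs : s = t ^ 2 + t + 1) (hst : t * s = 1) (hV : 0 ≤ V) (hVx : V ^ 2 = x 1 ^ 2 + x 2 ^ 2)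
    (n : ℕ) : |x (n + 2) + (1 + t) * x (n + 1) + s * x n| ≤ 3 * V := by
  have a1 : |x 1| ≤ V := abs_le_of_sq_le_sq (by nlinarith [sq_nonneg (x 2)]) hV
  have a2 : |x 2| ≤ V := abs_le_of_sq_le_sq (by nlinarith [sq_nonneg (x 1)]) hV
  rw [hx.contracting_mode hs hst, abs_mul, abs_of_nonneg (pow_nonneg (by linarith : 0 ≤ t) n)]
  have a3 : |x 2 + (1 + t) * x 1| ≤ 3 * V := by
    refine (abs_add_le _ _).trans ?_
    rw [abs_mul, abs_of_nonneg (by linarith : 0 ≤ 1 + t)]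
    nlinarith [abs_nonneg (x 1)]
  calc t ^ n * |x 2 + (1 + t) * x 1| ≤ 1 * (3 * V) := by
        gcongr
        exact pow_le_one₀ (by linarith) (by linarith)
    _ = 3 * V := one_mul _

theorem form_lower (hx : IsBackwardTrib x) (h1 : 27 / 50 ≤ t) (h2 : t ≤ 11 / 20)
    (hs : s = t ^ 2 + t + 1) (hst : t * s = 1) (hr : r ^ 2 = s) (hVx : V ^ 2 = x 1 ^ 2 + x 2 ^ 2)
    (n : ℕ) : (r ^ n * V) ^ 2 / 10 ≤ (x (n + 2) - t * x (n + 1)) ^ 2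
        + (1 + t) * (x (n + 1) - t * x n) * (x (n + 2) - t * x (n + 1))
        + s * (x (n + 1) - t * x n) ^ 2 := by
  have hs1 : 9 / 5 ≤ s := by nlinarith
  rw [hx.form_eq hs hst, mul_pow, ← pow_mul, mul_comm n 2, pow_mul, hr, mul_div_assoc]
  refine mul_le_mul_of_nonneg_left ?_ (pow_nonneg (by linarith) n)
  refine le_trans ?_ (trib_form_lower h1 h2 hs1)
  rw [hVx]
  nlinarith [sq_nonneg (x 2 - 2 * t * x 1), mul_nonneg (by nlinarith : 0 ≤ 1 / 2 - t ^ 2)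
    (sq_nonneg (x 1))]

theorem form_upper (hx : IsBackwardTrib x) (h1 : 27 / 50 ≤ t) (h2 : t ≤ 11 / 20)
    (hs : s = t ^ 2 + t + 1) (hst : t * s = 1) (hr : r ^ 2 = s) (hVx : V ^ 2 = x 1 ^ 2 + x 2 ^ 2)
    (n : ℕ) : (x (n + 2) - t * x (n + 1)) ^ 2
        + (1 + t) * (x (n + 1) - t * x n) * (x (n + 2) - t * x (n + 1))
        + s * (x (n + 1) - t * x n) ^ 2 ≤ (r ^ n * V) ^ 2 * 6 := by
  have hs1 : s ≤ 19 / 10 := by nlinarith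
  rw [hx.form_eq hs hst, mul_pow, ← pow_mul, mul_comm n 2, pow_mul, hr, mul_assoc (s ^ n)]
  refine mul_le_mul_of_nonneg_left ?_ (pow_nonneg (hr ▸ sq_nonneg r) n)
  refine le_trans (trib_form_upper h1 h2 hs1) ?_
  rw [hVx]
  nlinarith [sq_nonneg (x 2 + t * x 1), mul_nonneg (by nlinarith : 0 ≤ 31 / 100 - t ^ 2)
    (sq_nonneg (x 1)), sq_nonneg (x 1), sq_nonneg (x 2)]

/-- Write P = r^n V. If all three terms were below P/120, the contracting combination, at least -3V
≥ -P/30, would keep each above -P/15. The form would then be at most 2.7 · 2 · (7/60)² P² < P²/10,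
against `form_lower`. -/
theorem exists_large_term (hx : IsBackwardTrib x) (h1 : 27 / 50 ≤ t) (h2 : t ≤ 11 / 20)
    (hs : s = t ^ 2 + t + 1) (hst : t * s = 1) (hr : r ^ 2 = s) (hV : 0 < V)
    (hVx : V ^ 2 = x 1 ^ 2 + x 2 ^ 2) (n : ℕ) (hn : 90 ≤ r ^ n) :
    ∃ m, n ≤ m ∧ m ≤ n + 2 ∧ r ^ n * V / 120 ≤ x m := by
  by_contra! hcon
  have b0 := hcon n le_rfl (by omega)
  have b1 := hcon (n + 1) (by omega) (by omega)
  have b2 := hcon (n + 2) (by omega) le_rfl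
  have hz := abs_le.1 (hx.contracting_mode_abs_le h1 h2 hs hst hV.le hVx n)
  have hq := hx.form_lower h1 h2 hs hst hr hVx n
  have hs1 : 9 / 5 ≤ s := by nlinarith
  have hs2 : s ≤ 19 / 10 := by nlinarith
  have hP : 90 * V ≤ r ^ n * V := by gcongr
  set P := r ^ n * V
  have hP0 : 0 < P := by linarith
  generalize x n = u at *
  generalize x (n + 1) = v at *
  generalize x (n + 2) = w at *
  have key : ∀ {c y : ℝ}, 1 ≤ c → -(P / 15) ≤ c * y → -(P / 15) ≤ y := by
    intro c y hc h
    rcases le_total 0 y with hy | hy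
    · linarith
    · linarith [mul_le_mul_of_nonpos_right hc hy]
  have su : s * u ≤ 19 / 10 * (P / 120) :=
    (mul_le_mul_of_nonneg_left b0.le (by linarith)).trans
      (mul_le_mul_of_nonneg_right hs2 (by linarith))
  have sv : (1 + t) * v ≤ 31 / 20 * (P / 120) :=
    (mul_le_mul_of_nonneg_left b1.le (by linarith)).trans
      (mul_le_mul_of_nonneg_right (by linarith) (by linarith))
  have l0 : -(P / 15) ≤ u := key (c := s) (by linarith) (by linarith)
  have l1 : -(P / 15) ≤ v := key (c := 1 + t) (by linarith) (by linarith)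
  have l2 : -(P / 15) ≤ w := by linarith
  have tmul : ∀ {y : ℝ}, -(P / 15) ≤ y → y ≤ P / 120 → -(P / 20) ≤ t * y ∧ t * y ≤ P / 20 := by
    intro y hy hy'
    constructor
    · linarith [mul_le_mul_of_nonneg_left hy (by linarith : 0 ≤ t),
        mul_le_mul_of_nonneg_right h2 (by linarith : 0 ≤ P / 15)]
    · linarith [mul_le_mul_of_nonneg_left hy' (by linarith : 0 ≤ t),
        mul_le_mul_of_nonneg_right h2 (by linarith : 0 ≤ P / 120)]
  obtain ⟨tu, tu'⟩ := tmul l0 b0.le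
  obtain ⟨tv, tv'⟩ := tmul l1 b1.le
  have e0 : |v - t * u| ≤ 7 * P / 60 := by
    rw [_root_.abs_le]; constructor <;> linarith
  have e1 : |w - t * v| ≤ 7 * P / 60 := by
    rw [_root_.abs_le]; constructor <;> linarith
  have f0 := sq_le_sq' (abs_le.1 e0).1 (abs_le.1 e0).2
  have f1 := sq_le_sq' (abs_le.1 e1).1 (abs_le.1 e1).2
  have := trib_form_upper (a := v - t * u) (b := w - t * v) h1 h2 hs2
  linarith [pow_pos hP0 2]

theorem abs_le (hx : IsBackwardTrib x) (h1 : 27 / 50 ≤ t) (h2 : t ≤ 11 / 20)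
    (hs : s = t ^ 2 + t + 1) (hst : t * s = 1) (hr1 : 1 ≤ r) (hr : r ^ 2 = s) (hV : 0 ≤ V)
    (hVx : V ^ 2 = x 1 ^ 2 + x 2 ^ 2) (n : ℕ) : |x n| ≤ 25 * (r ^ n * V) := by
  have hs1 : 9 / 5 ≤ s := by nlinarith
  have hz := _root_.abs_le.1 (hx.contracting_mode_abs_le h1 h2 hs hst hV hVx n)
  have hq := (trib_form_lower h1 h2 hs1).trans (hx.form_upper h1 h2 hs hst hr hVx n)
  have hP : V ≤ r ^ n * V := le_mul_of_one_le_left hV (one_le_pow₀ hr1)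
  set P := r ^ n * V
  have hP0 : 0 ≤ P := hV.trans hP
  generalize x n = u at *
  generalize x (n + 1) = v at *
  generalize x (n + 2) = w at *
  have e0 := _root_.abs_le.1 (abs_le_of_sq_le_sq (a := v - t * u) (b := 6 * P)
    (by nlinarith [sq_nonneg (w - t * v)]) (by positivity))
  have e1 := _root_.abs_le.1 (abs_le_of_sq_le_sq (a := w - t * v) (b := 6 * P)
    (by nlinarith [sq_nonneg (v - t * u)]) (by positivity))
  -- The coefficient is the quadratic factor evaluated at t; this recovers x n from its two modes.
  have key : (s + t + 2 * t ^ 2) * u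
      = (w + (1 + t) * v + s * u) - (w - t * v) - (1 + 2 * t) * (v - t * u) := by ring
  have k1 : (1 + 2 * t) * (v - t * u) ≤ 15 * P := by nlinarith
  have k2 : -(15 * P) ≤ (1 + 2 * t) * (v - t * u) := by nlinarith
  have hc : 1 ≤ s + t + 2 * t ^ 2 := by nlinarith
  rw [_root_.abs_le]
  constructor
  · by_contra! h
    nlinarith
  · by_contra! h
    nlinarith

/-- When one difference vanishes, the form reduces to the square of the next, which is therefore of
order r^n V; the bounded t-mode then forces x n to be large. -/
theorem le_abs_of_eq (hx : IsBackwardTrib x) (h1 : 27 / 50 ≤ t) (h2 : t ≤ 11 / 20)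
    (hs : s = t ^ 2 + t + 1) (hst : t * s = 1) (hr0 : 0 ≤ r) (hr : r ^ 2 = s) (hV : 0 ≤ V)
    (hVx : V ^ 2 = x 1 ^ 2 + x 2 ^ 2) (n : ℕ) (hn : x (n + 1) - t * x n = 0) :
    r ^ n * V ≤ 16 * |x n| + 12 * V := by
  have hq := hx.form_lower h1 h2 hs hst hr hVx n
  have hz := hx.contracting_mode_abs_le h1 h2 hs hst hV hVx n
  rw [hn] at hq
  have hP0 : 0 ≤ r ^ n * V := by positivity
  set P := r ^ n * V
  have e1 : P ≤ 4 * |x (n + 2) - t * x (n + 1)| := by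
    refine _root_.le_of_sq_le_sq ?_ (by positivity)
    rw [mul_pow 4, sq_abs]
    nlinarith
  have key : x (n + 2) - t * x (n + 1) = (x (n + 2) + (1 + t) * x (n + 1) + s * x n)
      - (s + t + 2 * t ^ 2) * x n := by linear_combination (-(1 + 2 * t)) * hn
  have hc : s + t + 2 * t ^ 2 ≤ 4 := by nlinarith
  have hc0 : 0 ≤ s + t + 2 * t ^ 2 := by nlinarith
  have := abs_sub (x (n + 2) + (1 + t) * x (n + 1) + s * x n) ((s + t + 2 * t ^ 2) * x n)
  rw [← key, abs_mul, abs_of_nonneg hc0] at this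
  nlinarith [abs_nonneg (x n)]

end IsBackwardTrib

/-! ### Euclidean norms of integer vectors -/

theorem l2norm_eq_sqrt (v : Fin 2 → ℤ) : l2norm v = √((v 0 : ℝ) ^ 2 + (v 1 : ℝ) ^ 2) := by
  simp [l2norm, EuclideanSpace.norm_eq]

theorem l2norm_nonneg (v : Fin 2 → ℤ) : 0 ≤ l2norm v := norm_nonneg _

theorem l2norm_sq (v : Fin 2 → ℤ) : l2norm v ^ 2 = (v 0 : ℝ) ^ 2 + (v 1 : ℝ) ^ 2 := by
  rw [l2norm_eq_sqrt, Real.sq_sqrt (by positivity)]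

theorem l2norm_sub_le (v w : Fin 2 → ℤ) : l2norm (v - w) ≤ l2norm v + l2norm w := by
  have : WithLp.toLp 2 (fun i => ((v - w) i : ℝ))
      = WithLp.toLp 2 (fun i => (v i : ℝ)) - WithLp.toLp 2 (fun i => (w i : ℝ)) := by
    ext i; simp
  rw [l2norm, this]
  exact norm_sub_le _ _

/-- The square of the Euclidean norm of an integer vector, as a natural number. -/
def sqNorm (v : Fin 2 → ℤ) : ℕ := (v 0).natAbs ^ 2 + (v 1).natAbs ^ 2

theorem sqNorm_cast (v : Fin 2 → ℤ) : (sqNorm v : ℝ) = l2norm v ^ 2 := by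
  rw [l2norm_sq, sqNorm]
  push_cast
  simp [Nat.cast_natAbs]

theorem l2norm_le_iff {v w : Fin 2 → ℤ} : l2norm v ≤ l2norm w ↔ sqNorm v ≤ sqNorm w := by
  rw [← Nat.cast_le (α := ℝ), sqNorm_cast, sqNorm_cast,
    pow_le_pow_iff_left₀ (l2norm_nonneg v) (l2norm_nonneg w) two_ne_zero]

theorem sqNorm_pos {v : Fin 2 → ℤ} (hv : v ≠ 0) : 0 < sqNorm v := by
  by_contra! h
  apply hv
  have h0 : v 0 = 0 := by simp [sqNorm] at h; exact h.1
  have h1 : v 1 = 0 := by simp [sqNorm] at h; exact h.2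
  ext i
  fin_cases i <;> simp [h0, h1]

theorem one_le_l2norm {v : Fin 2 → ℤ} (hv : v ≠ 0) : 1 ≤ l2norm v := by
  have h : (1 : ℝ) ≤ sqNorm v := by exact_mod_cast sqNorm_pos hv
  rw [sqNorm_cast] at h
  nlinarith [l2norm_nonneg v]

/-! ### Growth and directions of the 3-bonacci vectors -/

theorem tribVec_isBackwardTrib (a b : ℝ) :
    IsBackwardTrib fun n => (tribVec n 0 : ℝ) * a + (tribVec n 1 : ℝ) * b where
  zero := by simp [tribVec]
  step n := by
    simp only [tribVec, Pi.sub_apply]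
    push_cast
    ring

theorem exists_pair_ne_zero_orthogonal (p q : ℝ) :
    ∃ a b : ℝ, 0 < a ^ 2 + b ^ 2 ∧ p * a + q * b = 0 := by
  by_cases h : p = 0
  · exact ⟨1, 0, by norm_num, by simp [h]⟩
  · exact ⟨-q, p, by positivity, by ring⟩

/-- The growth of the vectors `X_{-n}`, and the fact that any three consecutive ones meet every
half-plane. -/
theorem exists_tribVec_growth : ∃ r : ℝ, 1 < r ∧ r ≤ 7 / 5 ∧
    (∀ n, l2norm (tribVec n) ≤ 25 * r ^ n) ∧
    (∀ n, r ^ n ≤ 16 * l2norm (tribVec n) + 12) ∧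
    ∀ v : Fin 2 → ℤ, v ≠ 0 → ∀ n, 90 ≤ r ^ n → ∃ m, n ≤ m ∧ m ≤ n + 2 ∧
      r ^ n * l2norm v / 120 ≤ (tribVec m 0 : ℝ) * v 0 + (tribVec m 1 : ℝ) * v 1 := by
  obtain ⟨t, h1, h2, ht⟩ := exists_tribonacci_root
  obtain ⟨s, hs⟩ : ∃ s, s = t ^ 2 + t + 1 := ⟨_, rfl⟩
  have hst : t * s = 1 := by rw [hs]; linear_combination ht
  have hs1 : 9 / 5 ≤ s := by nlinarith
  have hs2 : s ≤ 19 / 10 := by nlinarith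
  have hr : √s ^ 2 = s := Real.sq_sqrt (by linarith)
  have hr0 : 0 ≤ √s := Real.sqrt_nonneg s
  have hr1 : 1 < √s := by nlinarith
  refine ⟨√s, hr1, by nlinarith, fun n => ?_, fun n => ?_, fun v hv n hn => ?_⟩
  -- Pairing with X_{-n} itself gives ‖X_{-n}‖² ≤ 25 r^n ‖X_{-n}‖.
  · have := (tribVec_isBackwardTrib (tribVec n 0) (tribVec n 1)).abs_le h1 h2 hs hst hr1.le hr
      (l2norm_nonneg (tribVec n)) (by simp [l2norm_sq, tribVec]) n
    simp only [← pow_two, ← l2norm_sq] at this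
    rw [abs_of_nonneg (by positivity)] at this
    have h0 := l2norm_nonneg (tribVec n)
    have hp : 0 ≤ √s ^ n := by positivity
    by_contra! hcon
    nlinarith
  -- Pair with a direction orthogonal to X_{-(n+1)} - t X_{-n}, so that `le_abs_of_eq` applies.
  · obtain ⟨a, b, hpos, hab⟩ := exists_pair_ne_zero_orthogonal
      ((tribVec (n + 1) 0 : ℝ) - t * tribVec n 0) ((tribVec (n + 1) 1 : ℝ) - t * tribVec n 1)
    have hV : √(a ^ 2 + b ^ 2) ^ 2 = a ^ 2 + b ^ 2 := Real.sq_sqrt hpos.le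
    have hV0 : 0 < √(a ^ 2 + b ^ 2) := Real.sqrt_pos.2 hpos
    have := (tribVec_isBackwardTrib a b).le_abs_of_eq h1 h2 hs hst hr0 hr hV0.le
      (by simp [hV, tribVec]) n (by linear_combination hab)
    have hcs : |(tribVec n 0 : ℝ) * a + tribVec n 1 * b|
        ≤ l2norm (tribVec n) * √(a ^ 2 + b ^ 2) := by
      refine abs_le_of_sq_le_sq ?_ (mul_nonneg (l2norm_nonneg _) hV0.le)
      rw [mul_pow, hV, l2norm_sq]
      nlinarith [sq_nonneg ((tribVec n 0 : ℝ) * b - tribVec n 1 * a)]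
    refine le_of_mul_le_mul_right ?_ hV0
    linarith
  · exact (tribVec_isBackwardTrib (v 0) (v 1)).exists_large_term h1 h2 hs hst hr
      (lt_of_lt_of_le one_pos (one_le_l2norm hv)) (by simp [l2norm_sq, tribVec]) n hn

/-! ### Runs, termination and the decomposition -/

theorem exists_isNearestIndex (v : Fin 2 → ℤ) : ∃ n, IsNearestIndex v n := by
  obtain ⟨n, hn, hmin⟩ := (measure fun n => sqNorm (v - tribVec n)).wf.has_min
    {n : ℕ | 1 ≤ n} ⟨1, le_refl 1⟩
  exact ⟨n, hn, fun m hm => l2norm_le_iff.2 (not_lt.1 (hmin m hm))⟩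

theorem exists_isGreedyRun (v : Fin 2 → ℤ) : ∃ w n, IsGreedyRun v w n := by
  choose f hf using exists_isNearestIndex
  let w : ℕ → (Fin 2 → ℤ) := fun i => (fun u => u - tribVec (f u))^[i] v
  exact ⟨w, fun i => f (w i), rfl, fun i => hf _, fun i => Function.iterate_succ_apply' _ _ _⟩

/-- Squared norms are naturals, so some iterate is shortest, and the step after it cannot shorten.
-/
theorem exists_stopsAt (w : ℕ → (Fin 2 → ℤ)) : ∃ M, StopsAt w M := by
  have hne : {i : ℕ | l2norm (w i) ≤ l2norm (w (i + 1))}.Nonempty := by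
    obtain ⟨i, -, hmin⟩ := (measure fun i => sqNorm (w i)).wf.has_min Set.univ ⟨0, trivial⟩
    exact ⟨i, l2norm_le_iff.2 (not_lt.1 (hmin (i + 1) trivial))⟩
  exact ⟨sInf _, Nat.sInf_mem hne, fun i hi => Nat.sInf_le hi⟩

theorem smallSteps_sum (v : Fin 2 → ℤ) : ((smallSteps v).map tribVec).sum = v := by
  unfold smallSteps
  split_ifs with h
  · ext i
    fin_cases i <;> simp [tribVec] <;> omega
  · push Not at h
    ext i
    fin_cases i <;> simp [tribVec, h]

theorem smallSteps_length_le (v : Fin 2 → ℤ) : (smallSteps v).length ≤ 3 * sqNorm v := by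
  have h0 : (v 0).natAbs ≤ (v 0).natAbs ^ 2 := Nat.le_self_pow two_ne_zero _
  have h1 : (v 1).natAbs ≤ (v 1).natAbs ^ 2 := Nat.le_self_pow two_ne_zero _
  unfold smallSteps sqNorm
  split_ifs with h
  · simp only [List.length_append, List.length_replicate]
    omega
  · simp only [List.length_append, List.length_replicate]
    omega

theorem le_three_of_mem_smallSteps {v : Fin 2 → ℤ} {k : ℕ} (hk : k ∈ smallSteps v) : k ≤ 3 := by
  unfold smallSteps at hk
  split_ifs at hk <;> simp only [List.mem_append, List.mem_replicate] at hk <;> omega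

theorem IsGreedyRun.sum_add {v : Fin 2 → ℤ} {w : ℕ → (Fin 2 → ℤ)} {n : ℕ → ℕ}
    (h : IsGreedyRun v w n) (M : ℕ) :
    (((List.range M).map n).map tribVec).sum + w M = v := by
  induction M with
  | zero => simp [h.start]
  | succ M ih =>
    rw [← ih, h.step, List.range_succ]
    simp

theorem IsGreedyRun.largeStepsIndices_sum {v : Fin 2 → ℤ} {w : ℕ → (Fin 2 → ℤ)} {n : ℕ → ℕ}
    (h : IsGreedyRun v w n) (M : ℕ) : ((largeStepsIndices w n M).map tribVec).sum = v := by
  rw [largeStepsIndices, List.map_append, List.sum_append, smallSteps_sum, h.sum_add]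

theorem List.foldr_max_le {l : List ℕ} {b : ℕ} (h : ∀ k ∈ l, k ≤ b) : l.foldr max 0 ≤ b := by
  induction l with
  | nil => simp
  | cons a l ih => simp_all

/-! ### Contraction and the logarithmic bound -/

/-- Above a threshold, a nearest step shortens a vector by a constant factor. -/
theorem exists_contraction : ∃ ρ R : ℝ, 0 < ρ ∧ ρ < 1 ∧ 1 ≤ R ∧ ∀ (v : Fin 2 → ℤ) (n : ℕ),
    IsNearestIndex v n → R ≤ sqNorm v → (sqNorm (v - tribVec n) : ℝ) ≤ ρ * sqNorm v := by
  obtain ⟨r, hr1, hr2, hup, -, hwin⟩ := exists_tribVec_growth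
  refine ⟨1 - 1 / 72000000, 54000000 ^ 2, by norm_num, by norm_num, by norm_num,
    fun v n hn hR => ?_⟩
  rw [sqNorm_cast] at hR
  have hV : 54000000 ≤ l2norm v :=
    (pow_le_pow_iff_left₀ (by norm_num) (l2norm_nonneg v) two_ne_zero).1 hR
  have hv : v ≠ 0 := by
    rintro rfl
    have : l2norm 0 = 0 := by simp [l2norm_eq_sqrt]
    linarith
  -- With r^k ≤ ‖v‖/300000 the quadratic term 2500 r^(2k) is at most half of the gain r^k ‖v‖/60. As
  -- r < 2, also r^k ≥ ‖v‖/600000: this is at least 90 above the threshold and gives the factor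
  -- 1/72000000 = 1/(120 · 600000).
  obtain ⟨k, hk1, hk2⟩ := exists_nat_pow_near (x := l2norm v / 300000) (by linarith) hr1
  have hk3 : l2norm v / 600000 ≤ r ^ k := by
    have hp : 0 < r ^ k := by positivity
    rw [pow_succ] at hk2
    nlinarith
  obtain ⟨m, hm1, hm2, hm⟩ := hwin v hv k (by linarith)
  have hk0 : k ≠ 0 := by
    rintro rfl
    norm_num at hk3
    linarith
  have hmup : l2norm (tribVec m) ≤ 50 * r ^ k := by
    refine (hup m).trans ?_
    have : r ^ m ≤ r ^ (k + 2) := pow_le_pow_right₀ hr1.le hm2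
    have hp : 0 < r ^ k := by positivity
    have hr : r ^ 2 ≤ 2 := by nlinarith
    rw [pow_add] at this
    linarith [mul_le_mul_of_nonneg_left hr hp.le]
  have hle : (sqNorm (v - tribVec n) : ℝ) ≤ sqNorm (v - tribVec m) := by
    exact_mod_cast l2norm_le_iff.1 (hn.2 m (by omega))
  refine hle.trans ?_
  have hexp : (sqNorm (v - tribVec m) : ℝ) = l2norm v ^ 2
      - 2 * ((tribVec m 0 : ℝ) * v 0 + (tribVec m 1 : ℝ) * v 1) + l2norm (tribVec m) ^ 2 := by
    simp only [sqNorm_cast, l2norm_sq, Pi.sub_apply]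
    push_cast
    ring
  have hsq : l2norm (tribVec m) ^ 2 ≤ (50 * r ^ k) ^ 2 :=
    pow_le_pow_left₀ (l2norm_nonneg _) hmup 2
  have h1 : r ^ k * r ^ k ≤ r ^ k * (l2norm v / 300000) := by gcongr
  have h2 : l2norm v / 600000 * l2norm v ≤ r ^ k * l2norm v := by gcongr
  rw [hexp, sqNorm_cast]
  linarith

/-- A strictly decreasing sequence of naturals that contracts geometrically above a threshold is
logarithmically short. -/
theorem length_le_log_of_contraction {ρ R : ℝ} (hρ0 : 0 < ρ) (hρ1 : ρ < 1) (hR : 1 ≤ R) (M : ℕ) :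
    ∀ E : ℕ → ℕ, (∀ i < M, E (i + 1) < E i) → (∀ i < M, R ≤ E i → (E (i + 1) : ℝ) ≤ ρ * E i) →
      (M : ℝ) ≤ Real.log (E 0) / (-Real.log ρ) + R := by
  have hlog : 0 < -Real.log ρ := by linarith [Real.log_neg hρ0 hρ1]
  induction M with
  | zero =>
    intro E _ _
    have := div_nonneg (Real.log_natCast_nonneg (E 0)) hlog.le
    rw [Nat.cast_zero]
    linarith
  | succ M ih =>
    intro E hdec hcon
    have hnn : 0 ≤ Real.log (E 0) / (-Real.log ρ) :=
      div_nonneg (Real.log_natCast_nonneg _) hlog.le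
    have hbound : ∀ i ≤ M + 1, E i + i ≤ E 0 := by
      intro i
      induction i with
      | zero => simp
      | succ i ih' =>
        intro hi
        have := hdec i (by omega)
        have := ih' (by omega)
        omega
    rcases lt_or_ge (E 0 : ℝ) R with h | h
    · have h3 : ((M + 1 : ℕ) : ℝ) ≤ E 0 := by
        exact_mod_cast le_trans (Nat.le_add_left _ _) (hbound (M + 1) le_rfl)
      linarith
    · have hstep := hcon 0 (by omega) h
      -- `Real.log 0 = 0` breaks the logarithmic descent, but a strictly decreasing sequence of
      -- naturals ends at 0.
      rcases Nat.eq_zero_or_pos (E 1) with h1 | h1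
      · have : M = 0 := by
          by_contra hM
          have := hdec 1 (by omega)
          omega
        subst this
        push_cast
        linarith
      · have h2 := ih (fun i => E (i + 1)) (fun i hi => hdec (i + 1) (by omega))
          (fun i hi => hcon (i + 1) (by omega))
        have hE1 : (0 : ℝ) < E 1 := by exact_mod_cast h1
        have h4 : Real.log (E 1) ≤ Real.log ρ + Real.log (E 0) := by
          rw [← Real.log_mul hρ0.ne' (by linarith)]
          exact Real.log_le_log hE1 hstep
        have h5 : Real.log (E 1) / (-Real.log ρ) ≤ Real.log (E 0) / (-Real.log ρ) - 1 := by
          rw [div_sub_one hlog.ne']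
          gcongr
          linarith
        push_cast
        simp only [zero_add] at h2
        linarith

theorem IsGreedyRun.largeStepsIndices_ne_nil {v : Fin 2 → ℤ} {w : ℕ → (Fin 2 → ℤ)} {n : ℕ → ℕ}
    (h : IsGreedyRun v w n) (hv : v ≠ 0) (M : ℕ) : largeStepsIndices w n M ≠ [] := by
  intro h0
  have := h.largeStepsIndices_sum M
  rw [h0] at this
  exact hv (by simpa using this.symm)

theorem StopsAt.sqNorm_lt {w : ℕ → (Fin 2 → ℤ)} {M : ℕ} (hM : StopsAt w M) {i : ℕ} (hi : i < M) :
    sqNorm (w (i + 1)) < sqNorm (w i) := by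
  by_contra! h
  exact absurd (hM.2 (l2norm_le_iff.2 h)) (not_le.2 hi)

theorem StopsAt.sqNorm_le {w : ℕ → (Fin 2 → ℤ)} {M : ℕ} (hM : StopsAt w M) {i : ℕ} (hi : i ≤ M) :
    sqNorm (w i) ≤ sqNorm (w 0) := by
  induction i with
  | zero => rfl
  | succ i ih => exact (hM.sqNorm_lt hi).le.trans (ih (by omega))

theorem exists_log_bound : ∃ c d : ℝ, 0 < c ∧ 0 < d ∧ ∀ v : Fin 2 → ℤ, v ≠ 0 → ∀ j : ℕ,
    IsJLsb v j → (j : ℝ) ≤ c * Real.log (l2norm v) + d := by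
  obtain ⟨ρ, R, hρ0, hρ1, hR, hcon⟩ := exists_contraction
  obtain ⟨r, hr1, -, -, hlow, -⟩ := exists_tribVec_growth
  have hlogρ : 0 < -Real.log ρ := by linarith [Real.log_neg hρ0 hρ1]
  have hlogr : 0 < Real.log r := Real.log_pos hr1
  have hlog44 : 0 < Real.log 44 := Real.log_pos (by norm_num)
  refine ⟨6 / (-Real.log ρ) + 1 / Real.log r, 12 * R + 3 + Real.log 44 / Real.log r,
    by positivity, by positivity, ?_⟩
  rintro v hv j ⟨w, n, M, hrun, hM, rfl⟩
  have hV := one_le_l2norm hv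
  have hlogV : 0 ≤ Real.log (l2norm v) := Real.log_nonneg hV
  have hMbound : (M : ℝ) ≤ 2 * Real.log (l2norm v) / (-Real.log ρ) + R := by
    have := length_le_log_of_contraction hρ0 hρ1 hR M (fun i => sqNorm (w i))
      (fun i hi => hM.sqNorm_lt hi)
      (fun i _ hi => by rw [hrun.step]; exact hcon _ _ (hrun.nearest i) hi)
    simpa [hrun.start, sqNorm_cast, Real.log_pow] using this
  -- Above the threshold the next step would still shorten, contradicting the stop.
  have hsmall : (sqNorm (w M) : ℝ) < R := by
    by_contra! h
    have h1 := hcon _ _ (hrun.nearest M) h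
    rw [← hrun.step] at h1
    have h2 : (sqNorm (w M) : ℝ) ≤ sqNorm (w (M + 1)) := by
      exact_mod_cast l2norm_le_iff.1 hM.1
    nlinarith
  have hlen : (((largeStepsIndices w n M).length - 1 : ℕ) : ℝ) ≤ M + 3 * R := by
    have h1 : (largeStepsIndices w n M).length - 1 ≤ M + 3 * sqNorm (w M) := by
      have := smallSteps_length_le (w M)
      simp only [largeStepsIndices, List.length_append, List.length_map, List.length_range]
      omega
    have h2 : (((largeStepsIndices w n M).length - 1 : ℕ) : ℝ) ≤ M + 3 * sqNorm (w M) := by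
      exact_mod_cast h1
    linarith
  have hindex : ∀ i < M, (n i : ℝ) ≤ (Real.log 44 + Real.log (l2norm v)) / Real.log r := by
    intro i hi
    have h1 : l2norm (w i) ≤ l2norm v := by
      rw [← hrun.start]; exact l2norm_le_iff.2 (hM.sqNorm_le hi.le)
    have h2 : l2norm (w (i + 1)) ≤ l2norm v := by
      rw [← hrun.start]; exact l2norm_le_iff.2 (hM.sqNorm_le hi)
    have h3 := l2norm_sub_le (w i) (w (i + 1))
    rw [hrun.step, sub_sub_cancel, ← hrun.step] at h3
    -- X_{-n_i} has norm at most 2‖v‖, and 16 · 2 + 12 = 44 since ‖v‖ ≥ 1.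
    have h4 : r ^ n i ≤ 44 * l2norm v := by linarith [hlow (n i)]
    rw [le_div_iff₀ hlogr, ← Real.log_mul (by norm_num) (by linarith), ← Real.log_pow]
    exact Real.log_le_log (by positivity) h4
  have hmax : (((largeStepsIndices w n M).foldr max 0 : ℕ) : ℝ)
      ≤ 3 + (Real.log 44 + Real.log (l2norm v)) / Real.log r := by
    refine le_trans (Nat.cast_le.2 (List.foldr_max_le
      (b := ⌊3 + (Real.log 44 + Real.log (l2norm v)) / Real.log r⌋₊) fun k hk => ?_))
      (Nat.floor_le (by positivity))
    have hnn : 0 ≤ (Real.log 44 + Real.log (l2norm v)) / Real.log r := by positivity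
    refine Nat.le_floor ?_
    rcases List.mem_append.1 hk with hk | hk
    · obtain ⟨i, hi, rfl⟩ := List.mem_map.1 hk
      linarith [hindex i (List.mem_range.1 hi)]
    · have : (k : ℝ) ≤ 3 := by exact_mod_cast le_three_of_mem_smallSteps hk
      linarith
  rw [indexBound]
  push_cast
  calc _ ≤ 3 * (2 * Real.log (l2norm v) / (-Real.log ρ) + R + 3 * R)
        + (3 + (Real.log 44 + Real.log (l2norm v)) / Real.log r) := by linarith
    _ = _ := by ring

/-! ### Sup norm and conclusion -/

theorem l2norm_le_two_mul_norm (v : Fin 2 → ℤ) : l2norm v ≤ 2 * ‖v‖ := by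
  have h0 : |(v 0 : ℝ)| ≤ ‖v‖ := by simpa [Int.norm_eq_abs] using norm_le_pi_norm v 0
  have h1 : |(v 1 : ℝ)| ≤ ‖v‖ := by simpa [Int.norm_eq_abs] using norm_le_pi_norm v 1
  refine le_of_sq_le_sq ?_ (by positivity)
  rw [l2norm_sq, ← sq_abs (v 0 : ℝ), ← sq_abs (v 1 : ℝ)]
  nlinarith [abs_nonneg (v 0 : ℝ), abs_nonneg (v 1 : ℝ)]

theorem mainTheorem4 :
    -- the procedure can be run, and every run stops and gives a decomposition of `v`
    (∀ v : Fin 2 → ℤ, v ≠ 0 → ∃ (w : ℕ → (Fin 2 → ℤ)) (n : ℕ → ℕ), IsGreedyRun v w n) ∧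
    (∀ (v : Fin 2 → ℤ) (w : ℕ → (Fin 2 → ℤ)) (n : ℕ → ℕ), v ≠ 0 → IsGreedyRun v w n →
      ∃ M : ℕ, StopsAt w M ∧ largeStepsIndices w n M ≠ [] ∧
        ((largeStepsIndices w n M).map tribVec).sum = v) ∧
    -- the logarithmic bound
    (∃ c₃ d₃ : ℝ, 0 < c₃ ∧ 0 < d₃ ∧ ∀ v : Fin 2 → ℤ, v ≠ 0 → ∀ j : ℕ, IsJLsb v j →
      (j : ℝ) ≤ c₃ * Real.log (l2norm v) + d₃) ∧
    -- `j_lsb = O(log ‖v‖₂)`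
    (∃ c R : ℝ, 0 < c ∧ ∀ v : Fin 2 → ℤ, v ≠ 0 → R ≤ l2norm v → ∀ j : ℕ, IsJLsb v j →
      (j : ℝ) ≤ c * |Real.log (l2norm v)|) ∧
    -- `j_lsb = O(log ‖v‖_∞)`
    (∃ c R : ℝ, 0 < c ∧ ∀ v : Fin 2 → ℤ, v ≠ 0 → R ≤ ‖v‖ → ∀ j : ℕ, IsJLsb v j →
      (j : ℝ) ≤ c * |Real.log ‖v‖|) := by

  obtain ⟨c, d, hc, hd, hbound⟩ := exists_log_bound
  -- The threshold e makes the logarithm at least 1, so that it absorbs d and, for the sup norm, log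
  -- 2.
  refine ⟨fun v _ => exists_isGreedyRun v, fun v w n hv h => ?_, ⟨c, d, hc, hd, hbound⟩,
    ⟨c + d, Real.exp 1, by positivity, fun v hv hR j hj => ?_⟩,
    ⟨2 * c + d, Real.exp 1, by positivity, fun v hv hR j hj => ?_⟩⟩
  · obtain ⟨M, hM⟩ := exists_stopsAt w
    exact ⟨M, hM, h.largeStepsIndices_ne_nil hv M, h.largeStepsIndices_sum M⟩
  · have h1 : 1 ≤ Real.log (l2norm v) :=
      (Real.le_log_iff_exp_le (lt_of_lt_of_le (Real.exp_pos 1) hR)).2 hR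
    rw [abs_of_nonneg (by linarith)]
    nlinarith [hbound v hv j hj]
  · have hpos : 0 < ‖v‖ := lt_of_lt_of_le (Real.exp_pos 1) hR
    have h1 : 1 ≤ Real.log ‖v‖ := (Real.le_log_iff_exp_le hpos).2 hR
    have h2 : Real.log (l2norm v) ≤ Real.log 2 + Real.log ‖v‖ := by
      rw [← Real.log_mul two_ne_zero hpos.ne']
      exact Real.log_le_log (by linarith [one_le_l2norm hv]) (l2norm_le_two_mul_norm v)
    have h3 : Real.log 2 ≤ 1 := by linarith [Real.log_two_lt_d9]
    rw [abs_of_nonneg (by linarith)]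
    have h4 : c * Real.log (l2norm v) ≤ c * (2 * Real.log ‖v‖) := by gcongr; linarith
    nlinarith [hbound v hv j hj]
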